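/- Let $\mathcal{E}$ be a locally presentable category and write $1$ for its terminal object. For a class $K$ of maps of $\mathcal{E}$ let $\mathrm{inj}(K)$ be the class of maps with the right lifting property with respect to every map in $K$, let $\mathrm{cof}(K)$ be the class of maps with the left lifting property with respect to every map in $\mathrm{inj}(K)$, and let $\mathrm{cell}(K)$ be the class of relative $K$-cell complexes, that is, of transfinite compositions of pushouts of coproducts of maps in $K$. Let $\mathrm{W}$ be a full accessible subcategory of the category of maps $\mathrm{Mor}(\mathcal{E})$ (that is, the full subcategory on the maps in $\mathrm{W}$ is an accessible category, and its inclusion into $\mathrm{Mor}(\mathcal{E})$ preserves $\kappa$-filtered colimits for some regular cardinal $\kappa$), and let $I$ and $J$ be two (small) sets of maps of $\mathcal{E}$. Call a map of $\mathcal{E}$ a naive fibration if it belongs to $\mathrm{inj}(J)$, and call an object $X$ naively fibrant if $X\to 1$ is a naive fibration. Suppose that - (c0) $\mathrm{W}$ has the two out of three property; - (c1) $\mathrm{inj}(I)\subset \mathrm{W}$; - (nc0) $\mathrm{W}$ has the weak invertibility property: if $r,s,t$ are maps such that the compositions $sr$ and $ts$ are defined and belong to $\mathrm{W}$, then $s$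 belongs to $\mathrm{W}$; - (nc1) $\mathrm{cell}(J)\subset \mathrm{cof}(I)\cap \mathrm{W}$; - (nc2) every map between naively fibrant objects that is both a naive fibration and in $\mathrm{W}$ belongs to $\mathrm{inj}(I)$. Then $\mathcal{E}$ has a (closed) model category structure with class of weak equivalences $\mathrm{W}$, class of cofibrations $\mathrm{cof}(I)$ and class of fibrations $\mathrm{inj}(\mathrm{cof}(I)\cap \mathrm{W})$. Moreover, an object of $\mathcal{E}$ is fibrant in this model structure if and only if it is naively fibrant, and a map between fibrant objects is a fibration if and only if it is a naive fibration. -/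

import Mathlib

namespace NaiveFibrations

open CategoryTheory Limits MorphismProperty

universe w v u

variable {E : Type u} [Category.{v} E]

/-- `inj(K)`: the maps with the right lifting property with respect to the maps in `K`. -/
def inj (K : MorphismProperty E) : MorphismProperty E := K.rlp

/-- `cof(K)`: the maps with the left lifting property with respect to the maps in `inj(K)`. -/
def cof (K : MorphismProperty E) : MorphismProperty E := (inj K).llp

/-- `cell(K)`: the relative `K`-cell complexes, i.e. the transfinite compositions (of any
`w`-small length) of pushouts of (`w`-small) coproducts of maps in `K`. -/
def cell (K : MorphismProperty E) : MorphismProperty E :=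
  transfiniteCompositions.{w} (coproducts.{w} K).pushouts

/-- The weak invertibility property: if `r`, `s`, `t` are composable (first `r`, then `s`,
then `t`) and the two composites of `r, s` and of `s, t` are in `W`, then `s` is in `W`. -/
def WeakInvertibility (W : MorphismProperty E) : Prop :=
  ∀ ⦃X₀ X₁ X₂ X₃ : E⦄ (r : X₀ ⟶ X₁) (s : X₁ ⟶ X₂) (t : X₂ ⟶ X₃),
    W (r ≫ s) → W (s ≫ t) → W s

/-- A class of maps, viewed as a property of objects of the category of maps `Mor(E)`. -/
def arrowProperty (W : MorphismProperty E) : ObjectProperty (Arrow E) := fun f ↦ W f.hom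

/-- `W` is a full accessible subcategory of `Mor(E)`: the full subcategory of `Mor(E)` on the
maps in `W` is an accessible category and its inclusion into `Mor(E)` is an accessible
functor (it preserves `κ`-filtered colimits for some regular cardinal `κ`). -/
structure IsFullAccessibleSubcategory (W : MorphismProperty E) : Prop where
  accessible : IsAccessibleCategory.{w} (arrowProperty W).FullSubcategory
  accessible_inclusion : Functor.IsAccessible.{w} (arrowProperty W).ι

/-- `X` is naively fibrant (with respect to `J`) if `X ⟶ 1` is in `inj(J)`. Since `inj(J)` is
stable under isomorphisms, the choice of the terminal object is irrelevant. -/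
def IsNaivelyFibrant (J : MorphismProperty E) (X : E) : Prop :=
  ∃ (T : E) (hT : IsTerminal T), inj J (hT.from X)

end NaiveFibrations

open CategoryTheory HomotopicalAlgebra NaiveFibrations

universe w v u


namespace NaiveFibrations

open Limits Cardinal

/-!
The cofibrations are `cof I`, and the small object argument splits every map into one of these
followed by one in `inj I ≤ W`. The rest is Smith's recognition theorem: if `W` satisfies the
solution set condition at `I`, the class `cof I ⊓ W` of trivial cofibrations is of the form `cof K`
for a small `K`, provided that `cof (cof I ⊓ W) ≤ cof I ⊓ W`. Accessibility of `W` enters through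
the solution set condition only: all the maps of `I` have `κ`-presentable ends for some `κ` such
that `W` is `κ`-accessible, so that the maps from `I` to `W` factor through the `κ`-presentable
objects of `W`.

The closure property of the trivial cofibrations holds because they are detected by the naive
fibrations between naively fibrant objects. Replace the ends of a map `i` by naively fibrant
objects, so that the replacement is a naive fibration `q`. If `i` is a trivial cofibration, then
`q` is in `W`, hence in `inj I`, and the lift of `i` against `q` reduces any lifting problem
against a naive fibration with naively fibrant target to one for a map in `cell J`. Conversely, if
`i` lifts against `q`, then weak invertibility applied to `i`, the lift and `q` gives `i` in `W`.
-/

/-! ### Colimits over a directed cover of a poset -/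

section DirectedCover

variable {C : Type u} [Category.{v} C] {α J : Type*} [Preorder α] [Preorder J]

/-- The restriction to a subset of a diagram indexed by a preorder. -/
abbrev restrictTo (F : α ⥤ C) (B : Set α) : B ⥤ C :=
  (Subtype.mono_coe (· ∈ B)).functor ⋙ F

variable (F : α ⥤ C) (A : J →o Set α) [∀ j, HasColimit (restrictTo F (A j))]

/-- The cocone over `F` restricted to a term of an increasing family of subsets `A` given by the
colimit of the restriction of `F` to a later term. -/
noncomputable abbrev transitionCocone {j k : J} (f : j ⟶ k) : Cocone (restrictTo F (A j)) where
  pt := colimit (restrictTo F (A k))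
  ι.app a := colimit.ι (restrictTo F (A k)) ⟨a, A.monotone (leOfHom f) a.2⟩
  ι.naturality a b g :=
    (colimit.w (restrictTo F (A k)) (homOfLE (show
      (⟨a, A.monotone (leOfHom f) a.2⟩ : A k) ≤ ⟨b, A.monotone (leOfHom f) b.2⟩
        from leOfHom g))).trans (Category.comp_id _).symm

/-- The diagram of the partial colimits `colim_{a ∈ A j} F a` of `F` along an increasing
family `A` of subsets of its indexing preorder. -/
noncomputable def partialColimits : J ⥤ C where
  obj j := colimit (restrictTo F (A j))
  map f := colimit.desc _ (transitionCocone F A f)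
  map_id _ := colimit.hom_ext fun _ ↦ (colimit.ι_desc _ _).trans (Category.comp_id _).symm
  map_comp f g := colimit.hom_ext fun a ↦ by
    rw [colimit.ι_desc, colimit.ι_desc_assoc]
    exact (colimit.ι_desc (transitionCocone F A g) ⟨a, A.monotone (leOfHom f) a.2⟩).symm

/-- The canonical map from a term of the diagram to a partial colimit. -/
noncomputable def ιPartialColimits (j : J) (a : α) (ha : a ∈ A j) :
    F.obj a ⟶ (partialColimits F A).obj j :=
  colimit.ι (restrictTo F (A j)) ⟨a, ha⟩

variable {F A} in
lemma partialColimits_hom_ext {j : J} {X : C} {f g : (partialColimits F A).obj j ⟶ X}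
    (h : ∀ a ha, ιPartialColimits F A j a ha ≫ f = ιPartialColimits F A j a ha ≫ g) : f = g :=
  colimit.hom_ext fun a ↦ h a a.2

lemma ιPartialColimits_map {j k : J} (f : j ⟶ k) (a : α) (ha : a ∈ A j) :
    ιPartialColimits F A j a ha ≫ (partialColimits F A).map f =
      ιPartialColimits F A k a (A.monotone (leOfHom f) ha) :=
  colimit.ι_desc _ _

lemma map_ιPartialColimits (j : J) {a b : α} (f : a ⟶ b) (ha : a ∈ A j) (hb : b ∈ A j) :
    F.map f ≫ ιPartialColimits F A j b hb = ιPartialColimits F A j a ha :=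
  colimit.w (restrictTo F (A j)) (homOfLE (show (⟨a, ha⟩ : A j) ≤ ⟨b, hb⟩ from leOfHom f))

variable {F} in
/-- The map from a partial colimit to the point of a cocone over the whole diagram. -/
noncomputable def partialColimitsDesc (c : Cocone F) (j : J) :
    (partialColimits F A).obj j ⟶ c.pt :=
  colimit.desc (restrictTo F (A j)) (c.whisker _)

lemma ιPartialColimits_desc (c : Cocone F) (j : J) (a : α) (ha : a ∈ A j) :
    ιPartialColimits F A j a ha ≫ partialColimitsDesc A c j = c.ι.app a :=
  colimit.ι_desc _ _

variable {F} in
/-- The cocone over the partial colimits of `F` induced by a cocone over `F`. -/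
noncomputable abbrev partialColimitsCocone (c : Cocone F) : Cocone (partialColimits F A) where
  pt := c.pt
  ι.app := partialColimitsDesc A c
  ι.naturality j k f := partialColimits_hom_ext fun a ha ↦ by
    simp only [Functor.const_obj_obj, Functor.const_obj_map, Category.comp_id,
      ← Category.assoc, ιPartialColimits_map, ιPartialColimits_desc]

variable {F A} [IsDirectedOrder J] (hA : ∀ a, ∃ j, a ∈ A j)

lemma ιPartialColimits_app_eq (s : Cocone (partialColimits F A)) {a : α} {j k : J}
    (hj : a ∈ A j) (hk : a ∈ A k) :
    ιPartialColimits F A j a hj ≫ s.ι.app j = ιPartialColimits F A k a hk ≫ s.ι.app k := by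
  obtain ⟨l, hjl, hkl⟩ := exists_ge_ge j k
  rw [← s.w (homOfLE hjl), ← s.w (homOfLE hkl), ← Category.assoc, ← Category.assoc,
    ιPartialColimits_map, ιPartialColimits_map]

/-- The cocone over `F` obtained by gluing a cocone over its partial colimits along a directed
cover. -/
noncomputable abbrev gluedCocone (s : Cocone (partialColimits F A)) : Cocone F where
  pt := s.pt
  ι.app a := ιPartialColimits F A (hA a).choose a (hA a).choose_spec ≫ s.ι.app _
  ι.naturality a b f := by
    obtain ⟨j, haj, hbj⟩ := exists_ge_ge (hA a).choose (hA b).choose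
    have ha : a ∈ A j := A.monotone haj (hA a).choose_spec
    have hb : b ∈ A j := A.monotone hbj (hA b).choose_spec
    rw [ιPartialColimits_app_eq s _ ha, ιPartialColimits_app_eq s _ hb, ← Category.assoc,
      map_ιPartialColimits F A j f ha hb]
    exact (Category.comp_id _).symm

/-- The colimit of a diagram indexed by a preorder is the colimit of its partial colimits along
a directed cover. -/
noncomputable def isColimitPartialColimitsCocone {c : Cocone F} (hc : IsColimit c) :
    IsColimit (partialColimitsCocone A c) where
  desc s := hc.desc (gluedCocone hA s)
  fac s j := partialColimits_hom_ext fun a ha ↦ by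
    have h : ιPartialColimits F A j a ha ≫ partialColimitsDesc A c j = c.ι.app a :=
      ιPartialColimits_desc F A c j a ha
    exact (Category.assoc _ _ _).symm.trans ((congr_arg (· ≫ _) h).trans
      ((hc.fac (gluedCocone hA s) a).trans (ιPartialColimits_app_eq s _ ha)))
  uniq s m hm := hc.hom_ext fun a ↦ by
    rw [hc.fac, ← ιPartialColimits_desc F A c _ a (hA a).choose_spec, Category.assoc]
    exact congr_arg (_ ≫ ·) (hm _)

end DirectedCover

/-! ### Raising the index of accessibility -/

section RaisingIndex

/-- The combinatorial form of "`κ₁` is sharply smaller than `κ₂`": the subsets of size `< κ₁` of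
any set of size `< κ₂` have a cofinal family of size `< κ₂`. This is used instead of
`Cardinal.SharplyLT`, which asks for the equivalent accessibility of `CardinalDirectedPoset κ₁`,
because it can be checked directly on successors of powers of `2`. -/
structure IsSharplySmaller (κ₁ κ₂ : Cardinal.{w}) : Prop where
  lt : κ₁ < κ₂
  exists_isCofinal (X : Type w) (hX : HasCardinalLT X κ₂) :
    ∃ Y : Set (CardinalDirectedPoset.SetCardinalLT κ₁ X), HasCardinalLT Y κ₂ ∧ IsCofinal Y

lemma hasCardinalLT_setCardinalLT {κ₁ κ : Cardinal.{w}} (h : κ₁ ≤ κ) (hκ : ℵ₀ ≤ κ) {X : Type w}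
    (hX : HasCardinalLT X (Order.succ (2 ^ κ))) :
    HasCardinalLT (CardinalDirectedPoset.SetCardinalLT κ₁ X) (Order.succ (2 ^ κ)) := by
  rw [hasCardinalLT_iff_cardinal_mk_lt, Order.lt_succ_iff] at hX ⊢
  calc
    #(CardinalDirectedPoset.SetCardinalLT κ₁ X) ≤ #{S : Set X // #S ≤ κ} :=
      mk_subtype_mono fun S hS ↦ ((hasCardinalLT_iff_cardinal_mk_lt _ _).1 hS).le.trans h
    _ ≤ max #X ℵ₀ ^ κ := mk_bounded_set_le X κ
    _ ≤ (2 ^ κ) ^ κ := power_le_power_right (max_le hX (hκ.trans (cantor κ).le))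
    _ = 2 ^ κ := by rw [← power_mul, mul_eq_self hκ]

lemma isSharplySmaller_succ_two_power {κ₁ κ : Cardinal.{w}} (h : κ₁ ≤ κ) (hκ : ℵ₀ ≤ κ) :
    IsSharplySmaller κ₁ (Order.succ (2 ^ κ)) where
  lt := (h.trans_lt (cantor κ)).trans (Order.lt_succ _)
  exists_isCofinal X hX := by
    refine ⟨Set.univ, ?_, .univ⟩
    rw [hasCardinalLT_iff_of_equiv (Equiv.Set.univ _)]
    exact hasCardinalLT_setCardinalLT h hκ hX

lemma hasCardinalLT_arrow_of_preorder {α : Type*} [Preorder α] {κ : Cardinal.{w}} (hκ : ℵ₀ ≤ κ)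
    (hα : HasCardinalLT α κ) : HasCardinalLT (Arrow α) κ :=
  (hasCardinalLT_prod hκ hα hα).of_injective (fun f ↦ (f.left, f.right)) fun f g hfg ↦ by
    obtain ⟨a, b, f⟩ := f
    obtain ⟨c, d, g⟩ := g
    obtain ⟨rfl, rfl⟩ := Prod.ext_iff.1 hfg
    obtain rfl := Subsingleton.elim f g
    rfl

/-- The `κ₁`-directed subsets of size `< κ₂` of a preorder. -/
abbrev SmallDirectedSubset (κ₁ κ₂ : Cardinal.{w}) [Fact κ₁.IsRegular] (α : Type w)
    [Preorder α] : Type w :=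
  {B : Set α // IsCardinalFiltered B κ₁ ∧ HasCardinalLT B κ₂}

variable {κ₁ κ₂ : Cardinal.{w}} [Fact κ₁.IsRegular] [Fact κ₂.IsRegular]

section

variable {α : Type w} [PartialOrder α] [IsCardinalFiltered α κ₁]

lemma exists_smallDirectedSubset_superset (h : IsSharplySmaller κ₁ κ₂) {A : Set α}
    (hA : HasCardinalLT A κ₂) : ∃ B : SmallDirectedSubset κ₁ κ₂ α, A ⊆ B.1 := by
  obtain ⟨B, hAB, hB⟩ :=
    SharplyLT.exists_isCardinalFiltered_set_of_exists_cofinal h.lt h.exists_isCofinal A hA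
  exact ⟨⟨B, hB⟩, hAB⟩

lemma exists_mem_smallDirectedSubset (h : IsSharplySmaller κ₁ κ₂) (a : α) :
    ∃ B : SmallDirectedSubset κ₁ κ₂ α, a ∈ B.1 := by
  have hκ₂ : κ₂.IsRegular := Fact.out
  obtain ⟨B, hB⟩ := exists_smallDirectedSubset_superset h
    (hasCardinalLT_of_finite ({a} : Set α) κ₂ hκ₂.aleph0_le)
  exact ⟨B, hB rfl⟩

lemma isCardinalFiltered_smallDirectedSubset (h : IsSharplySmaller κ₁ κ₂) :
    IsCardinalFiltered (SmallDirectedSubset κ₁ κ₂ α) κ₂ :=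
  isCardinalFiltered_preorder _ _ fun K B hK ↦ by
    rw [← hasCardinalLT_iff_cardinal_mk_lt] at hK
    obtain ⟨B', hB'⟩ := exists_smallDirectedSubset_superset h
      (hasCardinalLT_iUnion _ hK fun k ↦ (B k).2.2)
    exact ⟨B', fun k ↦ (Set.subset_iUnion (fun k ↦ (B k).1) k).trans hB'⟩

end

variable {C : Type u} [Category.{v} C]

lemma hasCardinalFilteredColimits_of_le {κ κ' : Cardinal.{w}} [Fact κ.IsRegular]
    [Fact κ'.IsRegular] [HasCardinalFilteredColimits C κ] (h : κ ≤ κ') :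
    HasCardinalFilteredColimits C κ' where
  hasColimitsOfShape J _ _ :=
    have := IsCardinalFiltered.of_le J h
    HasCardinalFilteredColimits.hasColimitsOfShape C κ J

lemma colimitsCardinalClosure_colimit_of_preorder (P : ObjectProperty C) {α : Type w}
    [Preorder α] (hα : HasCardinalLT α κ₂) (F : α ⥤ C) [HasColimit F] (hF : ∀ a, P (F.obj a)) :
    P.colimitsCardinalClosure κ₂ (colimit F) := by
  have hκ₂ : κ₂.IsRegular := Fact.out
  have := P.isClosedUnderColimitsOfShape_colimitsCardinalClosure κ₂ α
    (hasCardinalLT_arrow_of_preorder hκ₂.aleph0_le hα)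
  exact ObjectProperty.prop_colimit _ _ fun a ↦ P.le_colimitsCardinalClosure κ₂ _ (hF a)

lemma exists_colimitsOfShape_colimitsCardinalClosure [HasCardinalFilteredColimits C κ₁]
    (h : IsSharplySmaller κ₁ κ₂) {P : ObjectProperty C} {X : C}
    {J : Type w} [SmallCategory J] [IsCardinalFiltered J κ₁] (hX : P.colimitsOfShape J X) :
    ∃ (K : Type w) (_ : SmallCategory K) (_ : IsCardinalFiltered K κ₂),
      (P.colimitsCardinalClosure κ₂).colimitsOfShape K X := by
  obtain ⟨p⟩ := hX
  obtain ⟨α, _, _, G, _⟩ := IsCardinalFiltered.exists_cardinal_directed J κ₁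
  let p' := p.reindex G
  let A : SmallDirectedSubset κ₁ κ₂ α →o Set α := ⟨Subtype.val, fun _ _ h ↦ h⟩
  have (B : SmallDirectedSubset κ₁ κ₂ α) : HasColimit (restrictTo p'.diag (A B)) := by
    have := B.2.1
    have := HasCardinalFilteredColimits.hasColimitsOfShape C κ₁ (A B)
    infer_instance
  have := isCardinalFiltered_smallDirectedSubset (α := α) h
  have : IsDirectedOrder (SmallDirectedSubset κ₁ κ₂ α) :=
    have := isFiltered_of_isCardinalFiltered (SmallDirectedSubset κ₁ κ₂ α) κ₂
    IsFiltered.isDirectedOrder _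
  exact ⟨SmallDirectedSubset κ₁ κ₂ α, inferInstance, inferInstance, ⟨
    { diag := partialColimits p'.diag A
      ι := (partialColimitsCocone A p'.cocone).ι
      isColimit := isColimitPartialColimitsCocone (exists_mem_smallDirectedSubset h) p'.isColimit
      prop_diag_obj B := colimitsCardinalClosure_colimit_of_preorder P B.2.2 _
        fun b ↦ p'.prop_diag_obj b.1 }⟩⟩

lemma isCardinalAccessibleCategory_of_isSharplySmaller [IsCardinalAccessibleCategory C κ₁]
    (h : IsSharplySmaller κ₁ κ₂) : IsCardinalAccessibleCategory C κ₂ := by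
  obtain ⟨P, _, hP⟩ := HasCardinalFilteredGenerator.exists_generator C κ₁
  have := hasCardinalFilteredColimits_of_le (C := C) h.lt.le
  have hP' : (P.colimitsCardinalClosure κ₂).IsCardinalFilteredGenerator κ₂ :=
    ⟨P.colimitsCardinalClosure_le_isCardinalPresentable
      (hP.le_isCardinalPresentable.trans (isCardinalPresentable_monotone _ h.lt.le)), fun X ↦ by
        obtain ⟨J, _, _, hX⟩ := hP.exists_colimitsOfShape X
        exact exists_colimitsOfShape_colimitsCardinalClosure h hX⟩
  exact { toHasCardinalFilteredGenerator := hP'.hasCardinalFilteredGenerator }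

lemma exists_isCardinalAccessibleCategory_ge (C : Type u) [Category.{v} C]
    [IsAccessibleCategory.{w} C] (κ : Cardinal.{w}) :
    ∃ (κ' : Cardinal.{w}) (_ : Fact κ'.IsRegular), κ ≤ κ' ∧ IsCardinalAccessibleCategory C κ' := by
  obtain ⟨κ₁, hκ₁, _⟩ := IsAccessibleCategory.exists_cardinal.{w} C
  let μ := max κ κ₁
  have hμ : ℵ₀ ≤ μ := hκ₁.out.aleph0_le.trans (le_max_right κ κ₁)
  have hμ' : IsSharplySmaller κ₁ (Order.succ (2 ^ μ)) :=
    isSharplySmaller_succ_two_power (le_max_right κ κ₁) hμ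
  have : Fact (Order.succ ((2 : Cardinal.{w}) ^ μ)).IsRegular :=
    ⟨isRegular_succ (hμ.trans (cantor μ).le)⟩
  exact ⟨_, this, ((le_max_left κ κ₁).trans (cantor μ).le).trans (Order.le_succ _),
    isCardinalAccessibleCategory_of_isSharplySmaller hμ'⟩

end RaisingIndex

/-! ### Locally presentable categories -/

section LocallyPresentable

open MorphismProperty

lemma hasLimitsOfSize_of_isDense {J : Type w} [SmallCategory J] {D : Type u} [Category.{w} D]
    [HasColimitsOfSize.{w, w} D] (F : J ⥤ D) [F.IsDense] : HasLimitsOfSize.{w, w} D := by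
  have : (Presheaf.restrictedULiftYoneda.{w} F).IsRightAdjoint :=
    (Presheaf.uliftYonedaAdjunction.{w} _ (uliftYoneda.{w}.leftKanExtensionUnit F)).isRightAdjoint
  let : Reflective (Presheaf.restrictedULiftYoneda.{w} F) :=
    ⟨_, Adjunction.ofIsRightAdjoint (Presheaf.restrictedULiftYoneda.{w} F)⟩
  exact hasLimits_of_reflective (Presheaf.restrictedULiftYoneda.{w} F)

variable (C : Type u) [Category.{v} C]

lemma hasColimitsOfSize_of_isLocallyPresentable [IsLocallyPresentable.{w} C] :
    HasColimitsOfSize.{w, w} C := by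
  obtain ⟨κ, _, _⟩ := IsLocallyPresentable.exists_cardinal.{w} C
  infer_instance

lemma locallySmall_of_isLocallyPresentable [IsLocallyPresentable.{w} C] :
    LocallySmall.{w} C := by
  obtain ⟨κ, _, _⟩ := IsLocallyPresentable.exists_cardinal.{w} C
  infer_instance

lemma hasLimitsOfSize_of_isLocallyPresentable [IsLocallyPresentable.{w} C] :
    HasLimitsOfSize.{w, w} C := by
  have := locallySmall_of_isLocallyPresentable.{w} C
  let e := ShrinkHoms.equivalence.{w} C
  have := e.isLocallyPresentable
  obtain ⟨κ, _, _⟩ := IsLocallyPresentable.exists_cardinal.{w} (ShrinkHoms C)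
  let P := isCardinalPresentable (ShrinkHoms C) κ
  have := hasLimitsOfSize_of_isDense ((equivSmallModel.{w} P.FullSubcategory).inverse ⋙ P.ι)
  exact ⟨fun J _ ↦ Adjunction.hasLimitsOfShape_of_equivalence e.functor⟩

variable {C}

lemma exists_forall_isCardinalPresentable {ι : Type*} [Small.{w} ι] (X : ι → C)
    [∀ i, IsPresentable.{w} (X i)] :
    ∃ (κ : Cardinal.{w}) (_ : Fact κ.IsRegular), ∀ i, IsCardinalPresentable (X i) κ := by
  have h (i : ι) : ∃ (κ : Cardinal.{w}) (_ : Fact κ.IsRegular), IsCardinalPresentable (X i) κ :=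
    Functor.IsAccessible.exists_cardinal
  choose κ₀ _ hκ₀ using h
  obtain ⟨κ, hκ, h⟩ := HasCardinalLT.exists_regular_cardinal_forall.{w}
    (fun i ↦ (κ₀ i).ord.ToType)
  have : Fact κ.IsRegular := ⟨hκ⟩
  refine ⟨κ, this, fun i ↦ isCardinalPresentable_of_le (X i) (κ := κ₀ i) ?_⟩
  simpa [hasCardinalLT_iff_cardinal_mk_lt] using (h i).le

lemma hasSmallObjectArgument_of_isLocallyPresentable [IsLocallyPresentable.{w} C]
    (K : MorphismProperty C) [MorphismProperty.IsSmall.{w} K] : HasSmallObjectArgument.{w} K := by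
  have := locallySmall_of_isLocallyPresentable.{w} C
  have := hasColimitsOfSize_of_isLocallyPresentable.{w} C
  obtain ⟨κ, hκ, h⟩ := exists_forall_isCardinalPresentable.{w} fun i : K.toSet ↦ i.1.left
  have : Nonempty κ.ord.ToType := by simpa using hκ.out.ne_zero
  let := WellFoundedLT.toOrderBot κ.ord.ToType
  exact ⟨κ, inferInstance, inferInstance,
    { hasPushouts := have := hasFiniteColimits_of_hasColimitsOfSize.{w, w} C; inferInstance
      hasCoproducts := fun _ ↦ inferInstance
      hasIterationOfShape := { }
      preservesColimit {A _ _ _} i hi _ _ := by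
        have : IsCardinalPresentable A κ := h ⟨Arrow.mk i, hi⟩
        have := preservesColimitsOfShape_of_isCardinalPresentable A κ κ.ord.ToType
        infer_instance }⟩

end LocallyPresentable

/-! ### Relative cell complexes -/

section Cell

open MorphismProperty

variable {E : Type u} [Category.{v} E] {K K' : MorphismProperty E}

instance : (inj K).IsMultiplicative := inferInstanceAs K.rlp.IsMultiplicative

instance : (inj K).RespectsIso := inferInstanceAs K.rlp.RespectsIso

instance : (cof K).IsMultiplicative := inferInstanceAs (inj K).llp.IsMultiplicative

instance : (cof K).IsStableUnderCobaseChange :=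
  inferInstanceAs (inj K).llp.IsStableUnderCobaseChange

instance : (cof K).IsStableUnderRetracts := inferInstanceAs (inj K).llp.IsStableUnderRetracts

lemma le_cof (K : MorphismProperty E) : K ≤ cof K := le_llp_rlp K

lemma cof_mono (h : K ≤ K') : cof K ≤ cof K' := antitone_llp (antitone_rlp h)

lemma inj_cof (K : MorphismProperty E) : inj (cof K) = inj K := K.rlp_llp_rlp

lemma inj_le_of_le_cof (h : K ≤ cof K') : inj K' ≤ inj K := (le_llp_iff_le_rlp _ _).1 h

lemma le_cell (K : MorphismProperty E) : K ≤ cell.{w} K :=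
  K.le_coproducts.trans ((le_pushouts _).trans (le_transfiniteCompositions _))

lemma cell_le_cof (K : MorphismProperty E) : cell.{w} K ≤ cof K :=
  transfiniteCompositions_pushouts_coproducts_le_llp_rlp K

instance hasFactorization_cell_inj (K : MorphismProperty E) [HasSmallObjectArgument.{w} K] :
    (cell.{w} K).HasFactorization (inj K) where
  nonempty_mapFactorizationData f :=
    have : Fact K.smallObjectκ.IsRegular := smallObjectκ_isRegular K
    ⟨{ Z := SmallObject.obj K K.smallObjectκ f
       i := SmallObject.ιObj K K.smallObjectκ f
       p := SmallObject.πObj K K.smallObjectκ f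
       hi := transfiniteCompositionsOfShape_le_transfiniteCompositions _ _ _
          (SmallObject.transfiniteCompositionsOfShape_ιObj K K.smallObjectκ f)
       hp := SmallObject.rlp_πObj K K.smallObjectκ f }⟩

instance isWeakFactorizationSystem_cof_inj (K : MorphismProperty E)
    [HasSmallObjectArgument.{w} K] : IsWeakFactorizationSystem (cof K) (inj K) where
  rlp := inj_cof K
  llp := rfl
  hasFactorization := inferInstanceAs (K.rlp.llp.HasFactorization K.rlp)

end Cell

/-! ### The solution set condition -/

section SolutionSet

variable {E : Type u} [Category.{v} E]

/-- The solution set condition for `W` at `I`: the maps from a map in `I` to a map in `W` factor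
through a small family of maps in `W`. The family is uniform in the source, which is harmless
since `I` is meant to be small. -/
def SatisfiesSolutionSetCondition (W I : MorphismProperty E) : Prop :=
  ∃ S : MorphismProperty E, MorphismProperty.IsSmall.{w} S ∧ S ≤ W ∧
    ∀ ⦃i f : Arrow E⦄ (φ : i ⟶ f), I i.hom → W f.hom →
      ∃ (s : Arrow E) (a : i ⟶ s) (b : s ⟶ f), S s.hom ∧ a ≫ b = φ

lemma exists_hom_of_isColimit_arrow (κ : Cardinal.{w}) [Fact κ.IsRegular] {J : Type w}
    [SmallCategory J] [IsCardinalFiltered J κ] [HasColimitsOfShape J E] {F : J ⥤ Arrow E}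
    {c : Cocone F} (hc : IsColimit c) {f : Arrow E} [IsCardinalPresentable f.left κ]
    [IsCardinalPresentable f.right κ] (φ : f ⟶ c.pt) :
    ∃ (j : J) (ψ : f ⟶ F.obj j), ψ ≫ c.ι.app j = φ := by
  have := isFiltered_of_isCardinalFiltered J κ
  have hl := isColimitOfPreserves Arrow.leftFunc hc
  have hr := isColimitOfPreserves Arrow.rightFunc hc
  obtain ⟨j₁, a, ha⟩ : ∃ (j : J) (a : f.left ⟶ (F.obj j).left), a ≫ (c.ι.app j).left = φ.left :=
    IsCardinalPresentable.exists_hom_of_isColimit κ hl φ.left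
  obtain ⟨j₂, b, hb⟩ : ∃ (j : J) (b : f.right ⟶ (F.obj j).right),
      b ≫ (c.ι.app j).right = φ.right :=
    IsCardinalPresentable.exists_hom_of_isColimit κ hr φ.right
  have h : (a ≫ (F.obj j₁).hom) ≫ (c.ι.app j₁).right = (f.hom ≫ b) ≫ (c.ι.app j₂).right := by
    rw [Category.assoc, Category.assoc, hb, ← Arrow.w φ, ← ha, Category.assoc]
    exact congr_arg (a ≫ ·) (Arrow.w (c.ι.app j₁)).symm
  -- `a` and `b` need not form a square, but they do after moving on to a further stage.
  obtain ⟨k, u, v, huv⟩ : ∃ (k : J) (u : j₁ ⟶ k) (v : j₂ ⟶ k),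
      (a ≫ (F.obj j₁).hom) ≫ (F.map u).right = (f.hom ≫ b) ≫ (F.map v).right :=
    IsCardinalPresentable.exists_eq_of_isColimit κ hr _ _ h
  rw [Category.assoc, Category.assoc] at huv
  have hu : (F.map u).left ≫ (c.ι.app k).left = (c.ι.app j₁).left :=
    congr_arg Arrow.Hom.left (c.w u)
  have hv : (F.map v).right ≫ (c.ι.app k).right = (c.ι.app j₂).right :=
    congr_arg Arrow.Hom.right (c.w v)
  refine ⟨k, Arrow.homMk (a ≫ (F.map u).left) (b ≫ (F.map v).right) ?_, ?_⟩
  · rw [Category.assoc, Arrow.w, huv]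
  · ext
    · exact (Category.assoc _ _ _).trans ((congr_arg (a ≫ ·) hu).trans ha)
    · exact (Category.assoc _ _ _).trans ((congr_arg (b ≫ ·) hv).trans hb)

lemma IsFullAccessibleSubcategory.satisfiesSolutionSetCondition [IsAccessibleCategory.{w} E]
    {W : MorphismProperty E} (hW : IsFullAccessibleSubcategory.{w} W) (I : MorphismProperty E)
    [MorphismProperty.IsSmall.{w} I] : SatisfiesSolutionSetCondition.{w} W I := by
  have := hW.accessible
  have := hW.accessible_inclusion
  obtain ⟨κ₀, _, _⟩ := IsAccessibleCategory.exists_cardinal.{w} E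
  obtain ⟨κ₁, _, h₁⟩ := exists_forall_isCardinalPresentable.{w} fun i : I.toSet ↦ i.1.left
  obtain ⟨κ₂, _, h₂⟩ := exists_forall_isCardinalPresentable.{w} fun i : I.toSet ↦ i.1.right
  obtain ⟨κ₃, _, _⟩ := Functor.IsAccessible.exists_cardinal.{w} (F := (arrowProperty W).ι)
  obtain ⟨κ, _, hκ, _⟩ := exists_isCardinalAccessibleCategory_ge
    (arrowProperty W).FullSubcategory (max (max κ₀ κ₁) (max κ₂ κ₃))
  simp only [max_le_iff] at hκ
  obtain ⟨⟨hκ₀, hκ₁⟩, hκ₂, hκ₃⟩ := hκ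
  have := hasCardinalFilteredColimits_of_le (C := E) hκ₀
  have := (arrowProperty W).ι.isCardinalAccessible_of_le hκ₃
  obtain ⟨P, _, hP⟩ := HasCardinalFilteredGenerator.exists_small_generator
    (arrowProperty W).FullSubcategory κ
  refine ⟨.ofHoms fun s : Subtype P ↦ s.1.obj.hom, inferInstance, ?_, fun i f φ hi hf ↦ ?_⟩
  · rintro _ _ _ ⟨s⟩
    exact s.1.property
  · obtain ⟨J, _, _, ⟨p⟩⟩ := hP.exists_colimitsOfShape ⟨f, hf⟩
    have := HasCardinalFilteredColimits.hasColimitsOfShape E κ J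
    have := (arrowProperty W).ι.preservesColimitsOfShape_of_isCardinalAccessible κ J
    have : IsCardinalPresentable i.left κ₁ := h₁ ⟨i, hi⟩
    have : IsCardinalPresentable i.right κ₂ := h₂ ⟨i, hi⟩
    have := isCardinalPresentable_of_le i.left hκ₁
    have := isCardinalPresentable_of_le i.right hκ₂
    obtain ⟨j, ψ, hψ⟩ := exists_hom_of_isColimit_arrow κ
      (isColimitOfPreserves (arrowProperty W).ι p.isColimit) φ
    exact ⟨_, ψ, _, ⟨(⟨_, p.prop_diag_obj j⟩ : Subtype P)⟩, hψ⟩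

end SolutionSet

/-! ### Smith's recognition theorem -/

section Smith

variable {E : Type u} [Category.{v} E] {W I K : MorphismProperty E}

lemma exists_fac_cof_inf [HasPushouts E] [(cof I).HasFactorization (inj I)]
    [W.HasTwoOutOfThreeProperty] (hI : inj I ≤ W) {i f : Arrow E} (φ : i ⟶ f)
    (hi : cof I i.hom) (hf : W f.hom) :
    ∃ (j : Arrow E) (a : i ⟶ j) (b : j ⟶ f), (cof I ⊓ W) j.hom ∧ a ≫ b = φ := by
  -- Factor the comparison map from the pushout of `i` along the source of `φ`.
  let q : pushout i.hom φ.left ⟶ f.right := pushout.desc φ.right f.hom (Arrow.w φ).symm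
  let d := (cof I).factorizationData (inj I) q
  have facl : (pushout.inl i.hom φ.left ≫ d.i) ≫ d.p = φ.right := by
    rw [Category.assoc, d.fac, pushout.inl_desc]
  have facr : (pushout.inr i.hom φ.left ≫ d.i) ≫ d.p = f.hom := by
    rw [Category.assoc, d.fac, pushout.inr_desc]
  refine ⟨Arrow.mk (pushout.inr i.hom φ.left ≫ d.i),
    Arrow.homMk φ.left (pushout.inl i.hom φ.left ≫ d.i) ?_, Arrow.homMk (𝟙 _) d.p ?_, ⟨?_, ?_⟩, ?_⟩
  · simp [pushout.condition_assoc]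
  · simpa using facr.symm
  · exact (cof I).comp_mem _ _ ((cof I).pushout_inr _ _ hi) d.hi
  · exact W.of_postcomp _ d.p (hI _ d.hp) (facr ▸ hf :)
  · ext
    · exact Category.comp_id _
    · exact facl

lemma hasLiftingProperty_of_forall_fac {A B X Y : E} {i : A ⟶ B} {p : X ⟶ Y}
    (h : ∀ φ : Arrow.mk i ⟶ Arrow.mk p, ∃ (j : Arrow E) (a : Arrow.mk i ⟶ j)
      (b : j ⟶ Arrow.mk p), HasLiftingProperty j.hom p ∧ a ≫ b = φ) :
    HasLiftingProperty i p where
  sq_hasLift {f g} sq := by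
    obtain ⟨j, a, b, _, hab⟩ := h (Arrow.homMk f g sq.w)
    have sq' : CommSq b.left j.hom p b.right := ⟨Arrow.w b⟩
    have hl : a.left ≫ b.left = f := congr_arg Arrow.Hom.left hab
    have hr : a.right ≫ b.right = g := congr_arg Arrow.Hom.right hab
    have ha : a.left ≫ j.hom = i ≫ a.right := Arrow.w a
    exact ⟨⟨{ l := a.right ≫ sq'.lift
              fac_left := by rw [← reassoc_of% ha, sq'.fac_left, hl]
              fac_right := by rw [Category.assoc, sq'.fac_right, hr] }⟩⟩

lemma SatisfiesSolutionSetCondition.exists_isSmall_le_cof_inf [LocallySmall.{w} E] [HasPushouts E]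
    [(cof I).HasFactorization (inj I)] [W.HasTwoOutOfThreeProperty]
    [MorphismProperty.IsSmall.{w} I] (h : SatisfiesSolutionSetCondition.{w} W I)
    (hI : inj I ≤ W) :
    ∃ K : MorphismProperty E, MorphismProperty.IsSmall.{w} K ∧ K ≤ cof I ⊓ W ∧
      inj K ⊓ W ≤ inj I := by
  obtain ⟨S, _, hS, h⟩ := h
  have : Small.{w} S.toSet := ‹S.IsSmall›.small_toSet
  let ι := Σ x : I.toSet × S.toSet, (x.1.1 ⟶ x.2.1)
  have hι (x : ι) := exists_fac_cof_inf hI x.2 (le_cof I _ x.1.1.2) (hS _ x.1.2.2)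
  choose j a b hj fac using hι
  have : LocallySmall.{w} (Arrow E) := inferInstanceAs (LocallySmall.{w} (Comma (𝟭 E) (𝟭 E)))
  have : Small.{w} ι := inferInstance
  refine ⟨.ofHoms fun x ↦ (j x).hom, inferInstance, ?_, ?_⟩
  · rintro _ _ _ ⟨x⟩
    exact hj x
  · rintro X Y p ⟨hp, hpW⟩ A B i hi
    refine hasLiftingProperty_of_forall_fac fun φ ↦ ?_
    obtain ⟨s, α, β, hs, hαβ⟩ := h φ hi hpW
    let x : ι := ⟨⟨⟨Arrow.mk i, hi⟩, ⟨s, hs⟩⟩, α⟩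
    exact ⟨j x, a x, b x ≫ β, hp _ ⟨x⟩, by rw [← Category.assoc, fac x, hαβ]⟩

lemma cof_inf_eq_cof [(cof K).HasFactorization (inj K)] [W.HasTwoOutOfThreeProperty]
    (hK : cof K ≤ cof I ⊓ W) (hK' : inj K ⊓ W ≤ inj I) : cof I ⊓ W = cof K := by
  refine le_antisymm (fun A B i ⟨hi, hiW⟩ ↦ ?_) hK
  have d := (cof K).factorizationData (inj K) i
  have hpW : W d.p := W.of_precomp d.i d.p (hK _ d.hi).2 (by rwa [d.fac])
  have := hi _ (hK' _ ⟨d.hp, hpW⟩)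
  exact (cof K).of_retract (RetractArrow.ofLeftLiftingProperty d.fac) d.hi

theorem exists_isSmall_cof_inf_eq_cof [IsLocallyPresentable.{w} E] [W.HasTwoOutOfThreeProperty]
    [MorphismProperty.IsSmall.{w} I] (hW : SatisfiesSolutionSetCondition.{w} W I)
    (hI : inj I ≤ W) (hcof : cof (cof I ⊓ W) ≤ cof I ⊓ W) :
    ∃ K : MorphismProperty E, MorphismProperty.IsSmall.{w} K ∧ cof I ⊓ W = cof K ∧
      inj K ⊓ W = inj I := by
  have := locallySmall_of_isLocallyPresentable.{w} E
  have := hasColimitsOfSize_of_isLocallyPresentable.{w} E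
  have := hasFiniteColimits_of_hasColimitsOfSize.{w, w} E
  have := hasSmallObjectArgument_of_isLocallyPresentable.{w} I
  obtain ⟨K, _, hK, hK'⟩ := hW.exists_isSmall_le_cof_inf hI
  have := hasSmallObjectArgument_of_isLocallyPresentable.{w} K
  refine ⟨K, inferInstance, cof_inf_eq_cof ((cof_mono hK).trans hcof) hK', ?_⟩
  exact le_antisymm hK' (le_inf (inj_le_of_le_cof (hK.trans inf_le_left)) hI)

end Smith

/-! ### Naive fibrations between naively fibrant objects -/

section Naive

open MorphismProperty

variable {E : Type u} [Category.{v} E] {W I J : MorphismProperty E} {X Y : E}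

lemma isNaivelyFibrant_iff_of_isTerminal {T : E} (hT : IsTerminal T) :
    IsNaivelyFibrant J X ↔ inj J (hT.from X) := by
  refine ⟨fun ⟨T', hT', h⟩ ↦ ?_, fun h ↦ ⟨T, hT, h⟩⟩
  exact ((inj J).arrow_mk_iso_iff (Arrow.isoMk (Iso.refl X) (hT'.uniqueUpToIso hT)
    (hT.hom_ext _ _))).1 h

lemma IsNaivelyFibrant.of_isTerminal (J : MorphismProperty E) {T : E} (hT : IsTerminal T) :
    IsNaivelyFibrant J T :=
  ⟨T, hT, hT.hom_ext (𝟙 T) (hT.from T) ▸ (inj J).id_mem T⟩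

lemma IsNaivelyFibrant.of_inj (hY : IsNaivelyFibrant J Y) {f : X ⟶ Y} (hf : inj J f) :
    IsNaivelyFibrant J X := by
  obtain ⟨T, hT, h⟩ := hY
  exact ⟨T, hT, hT.hom_ext (f ≫ hT.from Y) (hT.from X) ▸ (inj J).comp_mem _ _ hf h⟩

lemma IsNaivelyFibrant.exists_extension (hX : IsNaivelyFibrant J X) {A B : E} {j : A ⟶ B}
    (hj : cof J j) (f : A ⟶ X) : ∃ g : B ⟶ X, j ≫ g = f := by
  obtain ⟨T, hT, h⟩ := hX
  have := hj _ h
  have sq : CommSq f j (hT.from X) (hT.from B) := ⟨hT.hom_ext _ _⟩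
  exact ⟨sq.lift, sq.fac_left⟩

variable (J) in
/-- The naive fibrations between naively fibrant objects. Only the target is asked to be naively
fibrant: the source then is so too, by `IsNaivelyFibrant.of_inj`. -/
def fibrantNaiveFibrations : MorphismProperty E :=
  fun _ Y f ↦ IsNaivelyFibrant J Y ∧ inj J f

section TrivialCofibrations

variable [W.HasTwoOutOfThreeProperty] [(cell.{w} J).HasFactorization (inj J)] [HasTerminal E]

variable (J) in
lemma exists_cell_isNaivelyFibrant (X : E) :
    ∃ (X' : E) (k : X ⟶ X'), cell.{w} J k ∧ IsNaivelyFibrant J X' := by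
  let d := factorizationData (cell.{w} J) (inj J) (terminal.from X)
  exact ⟨d.Z, d.i, d.hi, (IsNaivelyFibrant.of_isTerminal J terminalIsTerminal).of_inj d.hp⟩

variable (J) in
lemma exists_fac_fibrantNaiveFibrations {A B : E} (i : A ⟶ B) :
    ∃ (A' B' : E) (j : A ⟶ A') (k : B ⟶ B') (q : A' ⟶ B'), cell.{w} J j ∧ cell.{w} J k ∧
      fibrantNaiveFibrations J q ∧ CommSq j i q k := by
  obtain ⟨B', k, hk, hB'⟩ := exists_cell_isNaivelyFibrant.{w} J B
  let d := factorizationData (cell.{w} J) (inj J) (i ≫ k)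
  exact ⟨d.Z, B', d.i, k, d.p, d.hi, hk, ⟨hB', d.hp⟩, ⟨d.fac⟩⟩

lemma fibrantNaiveFibrations_le_inj_cof_inf (hJ : cell.{w} J ≤ W)
    (hI : fibrantNaiveFibrations J ⊓ W ≤ inj I) :
    fibrantNaiveFibrations J ≤ inj (cof I ⊓ W) := by
  intro X Y p ⟨hY, hp⟩ A B i ⟨hi, hiW⟩
  refine ⟨fun {f g} sq ↦ ?_⟩
  obtain ⟨A', B', j, k, q, hj, hk, hq, sqjk⟩ := exists_fac_fibrantNaiveFibrations.{w} J i
  have hqW : W q := W.of_precomp j q (hJ _ hj) (sqjk.w ▸ W.comp_mem _ _ hiW (hJ _ hk))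
  have := hi _ (hI _ ⟨hq, hqW⟩)
  obtain ⟨g', hg'⟩ := hY.exists_extension (cell_le_cof _ _ hk) g
  have := cell_le_cof _ _ hj _ hp
  have sq' : CommSq f j p (q ≫ g') := ⟨by rw [reassoc_of% sqjk.w, hg', sq.w]⟩
  exact ⟨⟨{ l := sqjk.lift ≫ sq'.lift }⟩⟩

lemma llp_fibrantNaiveFibrations_le (hW : WeakInvertibility W) (hJ : cell.{w} J ≤ W) :
    (fibrantNaiveFibrations J).llp ≤ W := by
  intro A B i hi
  obtain ⟨A', B', j, k, q, hj, hk, hq, sq⟩ := exists_fac_fibrantNaiveFibrations.{w} J i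
  have := hi q hq
  have hil : W (i ≫ sq.lift) := sq.fac_left.symm ▸ hJ _ hj
  have hlq : W (sq.lift ≫ q) := sq.fac_right.symm ▸ hJ _ hk
  exact W.of_postcomp i sq.lift (hW i sq.lift q hil hlq) hil

lemma cof_cof_inf_le (hW : WeakInvertibility W) (hJ : cell.{w} J ≤ W)
    (hI : fibrantNaiveFibrations J ⊓ W ≤ inj I) : cof (cof I ⊓ W) ≤ cof I ⊓ W := by
  refine le_inf (antitone_llp (inj_le_of_le_cof inf_le_left)) ?_
  exact (antitone_llp (fibrantNaiveFibrations_le_inj_cof_inf hJ hI)).trans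
    (llp_fibrantNaiveFibrations_le hW hJ)

end TrivialCofibrations

variable {K : MorphismProperty E}

lemma inj_iff_of_isNaivelyFibrant (hJ : J ≤ K) (hK : fibrantNaiveFibrations J ≤ inj K)
    {f : X ⟶ Y} (hY : IsNaivelyFibrant J Y) : inj K f ↔ inj J f :=
  ⟨antitone_rlp hJ f, fun hf ↦ hK f ⟨hY, hf⟩⟩

lemma isNaivelyFibrant_iff_of_le (hJ : J ≤ K) (hK : fibrantNaiveFibrations J ≤ inj K) :
    IsNaivelyFibrant K X ↔ IsNaivelyFibrant J X :=
  exists_congr fun _ ↦ exists_congr fun hT ↦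
    inj_iff_of_isNaivelyFibrant hJ hK (.of_isTerminal J hT)

end Naive

/-! ### Model structures -/

section ModelCategory

open HomotopicalAlgebra

variable {E : Type u} [Category.{v} E] {W I J : MorphismProperty E}

lemma isFibrant_iff_isNaivelyFibrant [CategoryWithFibrations E] [HasTerminal E]
    (hJ : fibrations E = inj J) (X : E) : IsFibrant X ↔ IsNaivelyFibrant J X := by
  rw [isFibrant_iff, fibration_iff, hJ, isNaivelyFibrant_iff_of_isTerminal terminalIsTerminal]
  rfl

lemma exists_modelCategory [HasFiniteLimits E] [HasFiniteColimits E]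
    {W C F : MorphismProperty E} [W.HasTwoOutOfThreeProperty]
    [hT : (C ⊓ W).IsWeakFactorizationSystem F] [hC : C.IsWeakFactorizationSystem (F ⊓ W)] :
    ∃ _ : ModelCategory E, weakEquivalences E = W ∧ cofibrations E = C ∧ fibrations E = F := by
  let : CategoryWithWeakEquivalences E := ⟨W⟩
  let : CategoryWithCofibrations E := ⟨C⟩
  let : CategoryWithFibrations E := ⟨F⟩
  have : (weakEquivalences E).HasTwoOutOfThreeProperty := ‹_›
  have : (trivialCofibrations E).IsWeakFactorizationSystem (fibrations E) := hT
  have : (cofibrations E).IsWeakFactorizationSystem (trivialFibrations E) := hC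
  exact ⟨ModelCategory.mk' E, rfl, rfl, rfl⟩

theorem exists_modelCategory_cof_inj [IsLocallyPresentable.{w} E]
    [MorphismProperty.IsSmall.{w} I] [W.HasTwoOutOfThreeProperty]
    (hW : SatisfiesSolutionSetCondition.{w} W I) (hI : inj I ≤ W)
    (hcof : cof (cof I ⊓ W) ≤ cof I ⊓ W) :
    ∃ _ : ModelCategory E, weakEquivalences E = W ∧ cofibrations E = cof I ∧
      fibrations E = inj (cof I ⊓ W) := by
  have := hasLimitsOfSize_of_isLocallyPresentable.{w} E
  have := hasColimitsOfSize_of_isLocallyPresentable.{w} E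
  have := hasFiniteLimits_of_hasLimitsOfSize.{w, w} E
  have := hasFiniteColimits_of_hasColimitsOfSize.{w, w} E
  have := hasSmallObjectArgument_of_isLocallyPresentable.{w} I
  obtain ⟨K, _, hK, hKI⟩ := exists_isSmall_cof_inf_eq_cof hW hI hcof
  have := hasSmallObjectArgument_of_isLocallyPresentable.{w} K
  have hinj : inj (cof I ⊓ W) = inj K := by rw [hK, inj_cof]
  have : (cof I ⊓ W).IsWeakFactorizationSystem (inj (cof I ⊓ W)) := by
    rw [hinj, hK]
    infer_instance
  have : (cof I).IsWeakFactorizationSystem (inj (cof I ⊓ W) ⊓ W) := by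
    rw [hinj, hKI]
    infer_instance
  exact exists_modelCategory

end ModelCategory

end NaiveFibrations

theorem proposition1p3_general {E : Type u} [Category.{v} E] [IsLocallyPresentable.{w} E]
    (W I J : MorphismProperty E)
    (hW : SatisfiesSolutionSetCondition.{w} W I)
    (hI : MorphismProperty.IsSmall.{w} I) (hJ : MorphismProperty.IsSmall.{w} J)
    (c0 : W.HasTwoOutOfThreeProperty)
    (c1 : inj I ≤ W)
    (nc0 : WeakInvertibility W)
    (nc1 : cell.{w} J ≤ cof I ⊓ W)
    (nc2 : ∀ ⦃X Y : E⦄ (f : X ⟶ Y), IsNaivelyFibrant J X → IsNaivelyFibrant J Y →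
      inj J f → W f → inj I f) :
    ∃ _ : ModelCategory E,
      weakEquivalences E = W ∧
      cofibrations E = cof I ∧
      fibrations E = inj (cof I ⊓ W) ∧
      (∀ X : E, IsFibrant X ↔ IsNaivelyFibrant J X) ∧
      (∀ ⦃X Y : E⦄ (f : X ⟶ Y), IsFibrant X → IsFibrant Y → (Fibration f ↔ inj J f)) := by
  have := hasLimitsOfSize_of_isLocallyPresentable.{w} E
  have := Limits.hasFiniteLimits_of_hasLimitsOfSize.{w, w} E
  have := hasSmallObjectArgument_of_isLocallyPresentable.{w} J
  have hJW : cell.{w} J ≤ W := nc1.trans inf_le_right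
  have hJI : fibrantNaiveFibrations J ⊓ W ≤ inj I :=
    fun _ _ f ⟨⟨hY, hf⟩, hfW⟩ ↦ nc2 f (hY.of_inj hf) hY hf hfW
  have hJT : J ≤ cof I ⊓ W := (le_cell.{w} J).trans nc1
  have hfib : fibrantNaiveFibrations J ≤ inj (cof I ⊓ W) :=
    fibrantNaiveFibrations_le_inj_cof_inf hJW hJI
  obtain ⟨_, hw, hc, hf⟩ := exists_modelCategory_cof_inj hW c1 (cof_cof_inf_le nc0 hJW hJI)
  have hfibrant (X : E) : IsFibrant X ↔ IsNaivelyFibrant J X :=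
    (isFibrant_iff_isNaivelyFibrant hf X).trans (isNaivelyFibrant_iff_of_le hJT hfib)
  refine ⟨_, hw, hc, hf, hfibrant, fun _ Y f _ hY ↦ ?_⟩
  rw [fibration_iff, hf]
  exact inj_iff_of_isNaivelyFibrant hJT hfib ((hfibrant Y).1 hY)

theorem proposition1p3 {E : Type u} [Category.{v} E] [IsLocallyPresentable.{w} E]
    (W I J : MorphismProperty E)
    (hW : IsFullAccessibleSubcategory.{w} W)
    (hI : MorphismProperty.IsSmall.{w} I) (hJ : MorphismProperty.IsSmall.{w} J)
    (c0 : W.HasTwoOutOfThreeProperty)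
    (c1 : inj I ≤ W)
    (nc0 : WeakInvertibility W)
    (nc1 : cell.{w} J ≤ cof I ⊓ W)
    (nc2 : ∀ ⦃X Y : E⦄ (f : X ⟶ Y), IsNaivelyFibrant J X → IsNaivelyFibrant J Y →
      inj J f → W f → inj I f) :
    ∃ _ : ModelCategory E,
      weakEquivalences E = W ∧
      cofibrations E = cof I ∧
      fibrations E = inj (cof I ⊓ W) ∧
      (∀ X : E, IsFibrant X ↔ IsNaivelyFibrant J X) ∧
      (∀ ⦃X Y : E⦄ (f : X ⟶ Y), IsFibrant X → IsFibrant Y → (Fibration f ↔ inj J f)) :=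
  proposition1p3_general W I J (hW.satisfiesSolutionSetCondition I) hI hJ c0 c1 nc0 nc1 nc2
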